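/- Throughout, for a metric space $Y$, $A\subseteq Y$ and $r\ge 0$ let $N_r(A)=\{y\in Y\mid d(y,A)\le r\}$, and say that $A$ is coarsely contained in $B$ if $A\subseteq N_r(B)$ for some $r\ge 0$. Let $Y^\infty$ be the space of eventually constant sequences in $Y$ with the sup metric, embed $Y^{n+1}$ in $Y^\infty$ by $i(y_0,\dots,y_n)=(y_0,\dots,y_n,y_n,y_n,\dots)$, and let $\Delta\subseteq Y^\infty$ be the set of constant sequences and $\Delta_A\subseteq\Delta$ the set of constant sequences at points of $A$. Let a group $G$ act on $Y$ by isometries with $GA=A$ and on an abelian group $R$ by automorphisms. Let $CX^n_G(Y-A;R)$ be the group of all functions $\varphi:Y^{n+1}\to R$ that are $G$-equivariant (for the diagonal action on $Y^{n+1}$) and such that, with $|\varphi|=\{i(\sigma)\mid \varphi(\sigma)\ne 0\}$, for every $r\ge 0$ the set $N_r(|\varphi|)\cap N_r(\Delta)$ is coarsely contained in $\Delta_A$. With the coboundary $(d\varphi)(y_0,\dots,y_{n+1})=\sum_{i=0}^{n+1}(-1)^i\varphi(y_0,\dots,\hat y_i,\dots,y_{n+1})$ these groups form a cochain complex; its cohomology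 is denoted $HX^*_G(Y-A;R)$ and called the $G$-equivariant coarse cohomology of the complement of $A$ in $Y$. For a metric space $X$ give $X^2=X\times X$ the sup metric and the action of $\mathbb{Z}_2$ that flips the coordinates, and let $\delta(X)=\{(x,x)\mid x\in X\}$. A map $f:X\to Y$ of metric spaces is called coarse expanding if the map $F(x,y)=(f(x),f(y))$ from $X^2$ to $Y^2$ satisfies: (i) for every $r\ge 0$, $F^{-1}(N_r(\delta(Y)))$ is coarsely contained in $\delta(X)$; (ii) there is a non-decreasing function $\mu:[0,\infty)\to[0,\infty)$ with $d(F(p),F(q))\le\mu(d(p,q))$ for all $p,q\in X^2$. For every abelian group $R$ with a $\mathbb{Z}_2$-action, such an $f$ induces homomorphisms \[f^*:HX^n_{\mathbb{Z}_2}(Y^2-\delta(Y);R)\to HX^n_{\mathbb{Z}_2}(X^2-\delta(X);R),\qquad (f^*\varphi)(p_0,\dots,p_n)=\varphi(F(p_0),\dots,F(p_n)).\] Let $\ell^\infty$ be the space of bounded real sequences with the sup norm. Proposition. Let $X$ be a metric space, let $R$ be an abelian group with an action of $\mathbb{Z}_2$ (possibly trivial), and let $f,g:X\to\ell^\infty$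 be coarse expanding maps. Then for every $n\ge 0$ the two induced homomorphisms \[f^*,\,g^*:HX^n_{\mathbb{Z}_2}\bigl((\ell^\infty)^2-\delta(\ell^\infty);R\bigr)\to HX^n_{\mathbb{Z}_2}\bigl(X^2-\delta(X);R\bigr)\] are equal, that is, $f^*(e)=g^*(e)$ for every class $e\in HX^n_{\mathbb{Z}_2}((\ell^\infty)^2-\delta(\ell^\infty);R)$. -/

import Mathlib

open scoped NNReal ENNReal

universe u v w

namespace CoarseConf

/-! ### Coarse containment and coarse intersection.
The metric neighbourhood `N_r(A) = {x | d(x, A) ≤ r}` is `Metric.cthickening r A`. -/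

/-- `A` is coarsely contained in `B`: `A ⊆ N_r(B)` for some `r ≥ 0`. -/
def CoarselyContained {Y : Type u} [PseudoEMetricSpace Y] (A B : Set Y) : Prop :=
  ∃ r : ℝ, 0 ≤ r ∧ A ⊆ Metric.cthickening r B

/-- The coarse intersection of `A` and `B` is coarsely contained in `C`: for every `r ≥ 0`,
`N_r(A) ∩ N_r(B)` is coarsely contained in `C`. -/
def CoarseInterContained {Y : Type u} [PseudoEMetricSpace Y] (A B C : Set Y) : Prop :=
  ∀ r : ℝ, 0 ≤ r → CoarselyContained (Metric.cthickening r A ∩ Metric.cthickening r B) C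

/-! ### Eventually constant sequences with the sup metric -/

/-- The space `X^∞` of eventually constant sequences in `X`. -/
def XInf (X : Type u) : Type u := {s : ℕ → X // ∃ N, ∀ k, N ≤ k → s k = s N}

/-- The sup metric on `X^∞`. -/
noncomputable instance XInf.instEMetricSpace (X : Type u) [MetricSpace X] :
    EMetricSpace (XInf X) where
  edist s t := ⨆ k, edist (s.1 k) (t.1 k)
  edist_self s := by simp
  edist_comm s t := by simp only [edist_comm]
  edist_triangle s t w := iSup_le fun k =>
    (edist_triangle _ (t.1 k) _).trans
      (add_le_add (le_iSup (fun k => edist (s.1 k) (t.1 k)) k)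
        (le_iSup (fun k => edist (t.1 k) (w.1 k)) k))
  eq_of_edist_eq_zero {s t} h := by
    apply Subtype.ext
    funext k
    exact edist_le_zero.1 ((le_iSup (fun k => edist (s.1 k) (t.1 k)) k).trans h.le)

theorem XInf.edist_def {X : Type u} [MetricSpace X] (s t : XInf X) :
    edist s t = ⨆ k, edist (s.1 k) (t.1 k) := rfl

/-- The stabilization `(x₀, …, xₙ) ↦ (x₀, …, xₙ, xₙ, xₙ, …)`. -/
def stab {X : Type u} {n : ℕ} (σ : Fin (n + 1) → X) : XInf X :=
  ⟨fun k => σ ⟨min k n, Nat.lt_succ_of_le (min_le_right k n)⟩,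
    n, fun k hk => by simp [min_eq_right hk]⟩

/-- The constant sequence `(x, x, x, …)`. -/
def constSeq {X : Type u} (x : X) : XInf X := ⟨fun _ => x, 0, fun _ _ => rfl⟩

/-- `Δ_A`, the set of constant sequences at points of `A`. -/
def diagOf {X : Type u} (A : Set X) : Set (XInf X) := constSeq '' A

theorem edist_stab_constSeq_le_iff {X : Type u} [MetricSpace X] {n : ℕ}
    (σ : Fin (n + 1) → X) (x : X) (p : ℝ≥0∞) :
    edist (stab σ) (constSeq x) ≤ p ↔ ∀ i, edist (σ i) x ≤ p := by
  rw [XInf.edist_def, iSup_le_iff]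
  constructor
  · intro h i
    have := h i
    have hi : min (i : ℕ) n = i := min_eq_left (Nat.le_of_lt_succ i.2)
    simpa [stab, constSeq, hi] using this
  · intro h k
    exact h _

/-! ### Cochains, the coboundary, and supports -/

/-- The Alexander--Spanier `n`-cochains of `X` with coefficients in `R`: all functions
`X^{n+1} → R`. -/
abbrev Cochain (X : Type u) (R : Type v) (n : ℕ) : Type (max u v) := (Fin (n + 1) → X) → R

/-- The coboundary
`(dφ)(x₀, …, xₙ₊₁) = ∑ᵢ (-1)ⁱ φ(x₀, …, x̂ᵢ, …, xₙ₊₁)`. -/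
def coboundary (X : Type u) (R : Type v) [AddCommGroup R] (n : ℕ) :
    Cochain X R n →+ Cochain X R (n + 1) where
  toFun φ σ := ∑ i : Fin (n + 2), (-1 : ℤ) ^ (i : ℕ) • φ (fun j => σ (i.succAbove j))
  map_zero' := by funext σ; simp
  map_add' φ ψ := by funext σ; simp [Finset.sum_add_distrib]

theorem coboundary_apply {X : Type u} {R : Type v} [AddCommGroup R] {n : ℕ}
    (φ : Cochain X R n) (σ : Fin (n + 2) → X) :
    coboundary X R n φ σ =
      ∑ i : Fin (n + 2), (-1 : ℤ) ^ (i : ℕ) • φ (fun j => σ (i.succAbove j)) := rfl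

theorem coboundary_coboundary {X : Type u} {R : Type v} [AddCommGroup R] {n : ℕ}
    (φ : Cochain X R n) : coboundary X R (n + 1) (coboundary X R n φ) = 0 := by
  funext σ
  simp only [coboundary_apply, Pi.zero_apply, Finset.smul_sum, smul_smul, ← pow_add]
  rw [← Finset.sum_product', Finset.univ_product_univ]
  refine Finset.sum_involution
    (fun ij _ => (ij.1.succAbove ij.2, ij.2.predAbove ij.1)) ?_ ?_ ?_ ?_
  · rintro ⟨i, j⟩ -
    have hs : ∀ k, (i.succAbove j).succAbove ((j.predAbove i).succAbove k) =
        i.succAbove (j.succAbove k) := fun k => Fin.succAbove_succAbove_succAbove_predAbove i j k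
    simp only [hs, Fin.neg_one_pow_succAbove_add_predAbove]
    rw [← add_smul]
    simp [pow_add]
  · rintro ⟨i, j⟩ - - h
    exact Fin.succAbove_ne i j (congrArg Prod.fst h)
  · intro _ _
    exact Finset.mem_univ _
  · rintro ⟨i, j⟩ -
    ext <;> simp [Fin.succAbove_succAbove_predAbove, Fin.predAbove_predAbove_succAbove]

/-- The stabilized support of a cochain. -/
def stabSupport {X : Type u} {R : Type v} [Zero R] {n : ℕ} (φ : Cochain X R n) :
    Set (XInf X) := stab '' Function.support φ

/-- The support condition for coarse cochains of the complement of `A` in `X`: the coarse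
intersection of the stabilized support of `φ` with `Δ` is coarsely contained in `Δ_A`. -/
def IsCoarseCochain {X : Type u} [MetricSpace X] {R : Type v} [Zero R] (A : Set X) {n : ℕ}
    (φ : Cochain X R n) : Prop :=
  CoarseInterContained (stabSupport φ) (diagOf Set.univ) (diagOf A)

theorem isCoarseCochain_iff {X : Type u} [MetricSpace X] {R : Type v} [Zero R] (A : Set X)
    {n : ℕ} (φ : Cochain X R n) :
    IsCoarseCochain A φ ↔ ∀ r : ℝ, 0 ≤ r → ∃ p : ℝ, 0 ≤ p ∧ ∀ σ : Fin (n + 1) → X, φ σ ≠ 0 →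
      (∀ i j, dist (σ i) (σ j) ≤ r) → ∃ a ∈ A, ∀ i, dist (σ i) a ≤ p := by
  constructor
  · intro h r hr
    obtain ⟨p, hp, hsub⟩ := h r hr
    refine ⟨p + 1, by linarith, fun σ hσ hd => ?_⟩
    have hmem : stab σ ∈ Metric.cthickening r (stabSupport φ) ∩
        Metric.cthickening r (diagOf (Set.univ : Set X)) := by
      refine ⟨Metric.self_subset_cthickening _ ⟨σ, hσ, rfl⟩, ?_⟩
      refine Metric.mem_cthickening_of_edist_le _ (constSeq (σ 0)) r _
        ⟨σ 0, Set.mem_univ _, rfl⟩ ?_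
      rw [edist_stab_constSeq_le_iff]
      intro i
      rw [edist_dist]
      exact ENNReal.ofReal_le_ofReal (hd i 0)
    have h1 := hsub hmem
    rw [Metric.mem_cthickening_iff] at h1
    have h2 : Metric.infEDist (stab σ) (diagOf A) < ENNReal.ofReal (p + 1) :=
      h1.trans_lt ((ENNReal.ofReal_lt_ofReal_iff (by linarith)).2 (by linarith))
    obtain ⟨_, ⟨a, ha, rfl⟩, hlt⟩ := Metric.infEDist_lt_iff.1 h2
    refine ⟨a, ha, fun i => ?_⟩
    have := (edist_stab_constSeq_le_iff σ a _).1 hlt.le i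
    rw [edist_dist] at this
    exact (ENNReal.ofReal_le_ofReal_iff (by linarith)).1 this
  · intro h r hr
    obtain ⟨p, hp, hσ⟩ := h (4 * (r + 1)) (by linarith)
    refine ⟨r + 1 + p, by linarith, ?_⟩
    rintro x ⟨hx1, hx2⟩
    have hr1 : ENNReal.ofReal r < ENNReal.ofReal (r + 1) :=
      (ENNReal.ofReal_lt_ofReal_iff (by linarith)).2 (by linarith)
    rw [Metric.mem_cthickening_iff] at hx1 hx2
    obtain ⟨_, ⟨σ, hsupp, rfl⟩, h1⟩ := Metric.infEDist_lt_iff.1 (hx1.trans_lt hr1)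
    obtain ⟨_, ⟨z, -, rfl⟩, h2⟩ := Metric.infEDist_lt_iff.1 (hx2.trans_lt hr1)
    have h3 : edist (stab σ) (constSeq z) ≤ ENNReal.ofReal (2 * (r + 1)) := by
      refine (edist_triangle _ x _).trans ?_
      rw [two_mul, ENNReal.ofReal_add (by linarith) (by linarith), edist_comm (stab σ) x]
      exact add_le_add h1.le h2.le
    have h4 : ∀ i, dist (σ i) z ≤ 2 * (r + 1) := by
      intro i
      have := (edist_stab_constSeq_le_iff σ z _).1 h3 i
      rw [edist_dist] at this
      exact (ENNReal.ofReal_le_ofReal_iff (by linarith)).1 this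
    obtain ⟨a, ha, hai⟩ := hσ σ hsupp fun i j => by
      have := dist_triangle_right (σ i) (σ j) z
      linarith [h4 i, h4 j]
    refine Metric.mem_cthickening_of_edist_le _ (constSeq a) _ _ ⟨a, ha, rfl⟩ ?_
    refine (edist_triangle _ (stab σ) _).trans ?_
    rw [ENNReal.ofReal_add (by linarith) hp]
    refine add_le_add h1.le ((edist_stab_constSeq_le_iff σ a _).2 fun i => ?_)
    rw [edist_dist]
    exact ENNReal.ofReal_le_ofReal (hai i)

/-! ### Equivariant coarse cohomology of the complement -/

section Complex

variable (G : Type w) [Group G] {X : Type u} [MetricSpace X] [MulAction G X]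
  (R : Type v) [AddCommGroup R] [DistribMulAction G R] (A : Set X)

/-- The group of `G`-equivariant coarse `n`-cochains of the complement of `A` in `X`; `G` acts
diagonally on `X^{n+1}`. -/
def eqCoarseCochain (n : ℕ) : AddSubgroup (Cochain X R n) where
  carrier := {φ | IsCoarseCochain A φ ∧
    ∀ (g : G) (σ : Fin (n + 1) → X), φ (fun i => g • σ i) = g • φ σ}
  zero_mem' := by
    refine ⟨(isCoarseCochain_iff _ _).2 fun r _ => ⟨0, le_rfl, fun σ h => ?_⟩, fun g σ => ?_⟩
    · exact absurd rfl h
    · simp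
  add_mem' := by
    rintro φ ψ ⟨h1, e1⟩ ⟨h2, e2⟩
    rw [isCoarseCochain_iff] at h1 h2
    refine ⟨(isCoarseCochain_iff _ _).2 fun r hr => ?_, fun g σ => ?_⟩
    · obtain ⟨p, hp, hφ⟩ := h1 r hr
      obtain ⟨q, hq, hψ⟩ := h2 r hr
      refine ⟨max p q, le_max_of_le_left hp, fun σ hσ hd => ?_⟩
      by_cases h : φ σ = 0
      · have h' : ψ σ ≠ 0 := fun h'' => hσ (by simp [h, h''])
        obtain ⟨a, ha, hi⟩ := hψ σ h' hd
        exact ⟨a, ha, fun i => (hi i).trans (le_max_right _ _)⟩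
      · obtain ⟨a, ha, hi⟩ := hφ σ h hd
        exact ⟨a, ha, fun i => (hi i).trans (le_max_left _ _)⟩
    · simp [e1, e2]
  neg_mem' := by
    rintro φ ⟨h1, e1⟩
    rw [isCoarseCochain_iff] at h1
    refine ⟨(isCoarseCochain_iff _ _).2 fun r hr => ?_, fun g σ => ?_⟩
    · obtain ⟨p, hp, hφ⟩ := h1 r hr
      exact ⟨p, hp, fun σ hσ => hφ σ fun h => hσ (by simp [h])⟩
    · simp [e1]

theorem coboundary_mem {n : ℕ} {φ : Cochain X R n} (hφ : φ ∈ eqCoarseCochain G R A n) :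
    coboundary X R n φ ∈ eqCoarseCochain G R A (n + 1) := by
  obtain ⟨h, e⟩ := hφ
  rw [isCoarseCochain_iff] at h
  refine ⟨(isCoarseCochain_iff _ _).2 fun r hr => ?_, fun g σ => ?_⟩
  · obtain ⟨p, hp, hσ⟩ := h r hr
    refine ⟨p + r, by linarith, fun σ hne hd => ?_⟩
    rw [coboundary_apply] at hne
    obtain ⟨i, -, hi⟩ := Finset.exists_ne_zero_of_sum_ne_zero hne
    have hi' : φ (fun j => σ (i.succAbove j)) ≠ 0 := fun h0 => hi (by rw [h0, smul_zero])
    obtain ⟨a, ha, haj⟩ := hσ _ hi' fun j k => hd _ _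
    refine ⟨a, ha, fun k => ?_⟩
    have := dist_triangle (σ k) (σ (i.succAbove 0)) a
    linarith [haj 0, hd k (i.succAbove 0)]
  · simp only [coboundary_apply, Finset.smul_sum]
    refine Finset.sum_congr rfl fun i _ => ?_
    rw [e g (fun j => σ (i.succAbove j))]
    exact (map_zsmul (DistribSMul.toAddMonoidHom R g) _ _).symm

/-- The coboundary operator of the complex of equivariant coarse cochains. -/
def eqCoarseD (n : ℕ) : eqCoarseCochain G R A n →+ eqCoarseCochain G R A (n + 1) :=
  ((coboundary X R n).comp (eqCoarseCochain G R A n).subtype).codRestrict _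
    fun φ => coboundary_mem G R A φ.2

/-- The cocycles. -/
def eqCocycles (n : ℕ) : AddSubgroup (eqCoarseCochain G R A n) := (eqCoarseD G R A n).ker

/-- The coboundaries (zero in degree `0`). -/
def eqCoboundaries : (n : ℕ) → AddSubgroup (eqCoarseCochain G R A n)
  | 0 => ⊥
  | n + 1 => (eqCoarseD G R A n).range

theorem eqCoboundaries_le (n : ℕ) : eqCoboundaries G R A n ≤ eqCocycles G R A n := by
  cases n with
  | zero => exact bot_le
  | succ n =>
    rintro _ ⟨φ, rfl⟩
    exact AddMonoidHom.mem_ker.2 (Subtype.ext (coboundary_coboundary φ.1))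

/-- The `G`-equivariant coarse cohomology of the complement of `A` in `X`, in degree `n`:
cocycles modulo coboundaries. -/
abbrev EqCoarseCohomology (n : ℕ) : Type (max u v) :=
  eqCocycles G R A n ⧸ (eqCoboundaries G R A n).addSubgroupOf (eqCocycles G R A n)

end Complex

/-! ### Relatively coarse maps and induced maps -/

section Maps

variable {X : Type u} [MetricSpace X] {Y : Type w} [MetricSpace Y]

/-- `f : (X, A) → (Y, B)` is relatively proper. -/
def IsRelativelyProper (f : X → Y) (A : Set X) (B : Set Y) : Prop :=
  ∀ r : ℝ, 0 ≤ r → CoarselyContained (f ⁻¹' Metric.cthickening r B) A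

/-- `f : (X, A) → (Y, B)` is relatively coarse. -/
def IsRelativelyCoarse (f : X → Y) (A : Set X) (B : Set Y) : Prop :=
  IsRelativelyProper f A B ∧
    ∃ μ : ℝ≥0 → ℝ≥0, Monotone μ ∧ ∀ x y, nndist (f x) (f y) ≤ μ (nndist x y)

theorem IsRelativelyCoarse.comp_isCoarseCochain {R : Type v} [Zero R] {f : X → Y} {A : Set X}
    {B : Set Y} (hf : IsRelativelyCoarse f A B) {n : ℕ} {φ : Cochain Y R n}
    (hφ : IsCoarseCochain B φ) :
    IsCoarseCochain (X := X) A (fun σ => φ (fun i => f (σ i)) : Cochain X R n) := by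
  obtain ⟨hprop, μ, hμ, hle⟩ := hf
  rw [isCoarseCochain_iff] at hφ ⊢
  intro r hr
  obtain ⟨p, hp, hσ⟩ := hφ (μ ⟨r, hr⟩) (μ ⟨r, hr⟩).2
  obtain ⟨q, hq, hsub⟩ := hprop p hp
  refine ⟨r + (q + 1), by linarith, fun σ hne hd => ?_⟩
  obtain ⟨b, hb, hbi⟩ := hσ _ hne fun i j => by
    have h1 : nndist (σ i) (σ j) ≤ ⟨r, hr⟩ := hd i j
    exact_mod_cast (hle (σ i) (σ j)).trans (hμ h1)
  have h0 : σ 0 ∈ Metric.cthickening q A :=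
    hsub (Metric.mem_cthickening_of_dist_le _ b p _ hb (hbi 0))
  rw [Metric.mem_cthickening_iff] at h0
  have h1 : Metric.infEDist (σ 0) A < ENNReal.ofReal (q + 1) :=
    h0.trans_lt ((ENNReal.ofReal_lt_ofReal_iff (by linarith)).2 (by linarith))
  obtain ⟨a, ha, hlt⟩ := Metric.infEDist_lt_iff.1 h1
  rw [edist_dist] at hlt
  have hlt' := (ENNReal.ofReal_lt_ofReal_iff (by linarith)).1 hlt
  refine ⟨a, ha, fun i => ?_⟩
  have := dist_triangle (σ i) (σ 0) a
  linarith [hd i 0]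

variable {G : Type*} [Group G] [MulAction G X] [MulAction G Y]
  (R : Type v) [AddCommGroup R] [DistribMulAction G R]

/-- The cochain map `(f^*φ)(x₀, …, xₙ) = φ(f x₀, …, f xₙ)` induced by an equivariant relatively
coarse map. -/
def eqPullback {A : Set X} {B : Set Y} (f : X → Y) (hf : IsRelativelyCoarse f A B)
    (hG : ∀ (g : G) (x : X), f (g • x) = g • f x) (n : ℕ) :
    eqCoarseCochain G R B n →+ eqCoarseCochain G R A n where
  toFun φ := ⟨fun σ => φ.1 (fun i => f (σ i)), hf.comp_isCoarseCochain φ.2.1, fun g σ => by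
    simp only [hG]
    exact φ.2.2 g (fun i => f (σ i))⟩
  map_zero' := rfl
  map_add' _ _ := rfl

theorem eqPullback_d {A : Set X} {B : Set Y} (f : X → Y) (hf : IsRelativelyCoarse f A B)
    (hG : ∀ (g : G) (x : X), f (g • x) = g • f x) (n : ℕ) (φ : eqCoarseCochain G R B n) :
    eqPullback R f hf hG (n + 1) (eqCoarseD G R B n φ) =
      eqCoarseD G R A n (eqPullback R f hf hG n φ) := rfl

/-- The restriction of `f^*` to cocycles. -/
def eqPullbackCocycles {A : Set X} {B : Set Y} (f : X → Y) (hf : IsRelativelyCoarse f A B)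
    (hG : ∀ (g : G) (x : X), f (g • x) = g • f x) (n : ℕ) :
    eqCocycles G R B n →+ eqCocycles G R A n :=
  ((eqPullback R f hf hG n).comp (eqCocycles G R B n).subtype).codRestrict _ fun φ =>
    AddMonoidHom.mem_ker.2 (by
      have h : eqCoarseD G R B n φ.1 = 0 := AddMonoidHom.mem_ker.1 φ.2
      have := eqPullback_d R f hf hG n φ.1
      rw [h, map_zero] at this
      exact this.symm)

theorem eqPullback_mem_coboundaries {A : Set X} {B : Set Y} (f : X → Y)
    (hf : IsRelativelyCoarse f A B) (hG : ∀ (g : G) (x : X), f (g • x) = g • f x) (n : ℕ)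
    {φ : eqCoarseCochain G R B n} (hφ : φ ∈ eqCoboundaries G R B n) :
    eqPullback R f hf hG n φ ∈ eqCoboundaries G R A n := by
  cases n with
  | zero =>
    have h : φ = 0 := hφ
    subst h
    exact map_zero (eqPullback R f hf hG 0)
  | succ n =>
    obtain ⟨ψ, rfl⟩ := hφ
    exact ⟨eqPullback R f hf hG n ψ, (eqPullback_d R f hf hG n ψ).symm⟩

/-- The map `f^*` induced on equivariant coarse cohomology. -/
def eqCohomologyMap {A : Set X} {B : Set Y} (f : X → Y) (hf : IsRelativelyCoarse f A B)
    (hG : ∀ (g : G) (x : X), f (g • x) = g • f x) (n : ℕ) :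
    EqCoarseCohomology G R B n →+ EqCoarseCohomology G R A n :=
  QuotientAddGroup.map _ _ (eqPullbackCocycles R f hf hG n) fun _ hφ =>
    eqPullback_mem_coboundaries R f hf hG n hφ

end Maps

/-! ### The configuration space -/

/-- The group `ℤ/2`, written multiplicatively. -/
abbrev Z2 : Type := Multiplicative (ZMod 2)

/-- The square `X² = X × X`, with the sup metric and the flip action of `ℤ/2`. -/
def Sq (X : Type u) : Type u := X × X

noncomputable instance Sq.instMetricSpace (X : Type u) [MetricSpace X] : MetricSpace (Sq X) :=
  inferInstanceAs (MetricSpace (X × X))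

/-- The flip `(x, y) ↦ (y, x)`. -/
def Sq.flip {X : Type u} (p : Sq X) : Sq X := (p.2, p.1)

/-- The nontrivial element of `ℤ/2` acts by the flip. -/
instance Sq.instMulAction (X : Type u) : MulAction Z2 (Sq X) where
  smul g p := if g = 1 then p else p.flip
  one_smul p := if_pos rfl
  mul_smul g h p := by
    have key : ∀ g h : Z2, (g = 1 ∧ g * h = h) ∨ (h = 1 ∧ g * h = g) ∨
        (g ≠ 1 ∧ h ≠ 1 ∧ g * h = 1) := by decide
    change (if g * h = 1 then p else p.flip) =
      if g = 1 then (if h = 1 then p else p.flip) else (if h = 1 then p else p.flip).flip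
    rcases key g h with ⟨h1, h2⟩ | ⟨h1, h2⟩ | ⟨h1, h2, h3⟩
    · rw [h2, if_pos h1]
    · rw [h2, if_pos h1]
    · rw [if_pos h3, if_neg h1, if_neg h2]
      rfl

theorem Sq.smul_def {X : Type u} (g : Z2) (p : Sq X) :
    g • p = if g = 1 then p else p.flip := rfl

/-- The action is by isometries. -/
instance Sq.instIsIsometricSMul (X : Type u) [MetricSpace X] : IsIsometricSMul Z2 (Sq X) where
  isometry_smul g := by
    refine Isometry.of_dist_eq fun p q => ?_
    rw [Sq.smul_def, Sq.smul_def]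
    by_cases h : g = 1
    · rw [if_pos h, if_pos h]
    · rw [if_neg h, if_neg h]
      exact max_comm (dist p.2 q.2) (dist p.1 q.1)

/-- The diagonal `δ(X) = {(x, x)}` of `X²`. -/
def delta (X : Type u) : Set (Sq X) := {p | p.1 = p.2}

/-- The map `(x, y) ↦ (f x, f y)`. -/
def sqMap {X : Type u} {Y : Type w} (f : X → Y) : Sq X → Sq Y := fun p => (f p.1, f p.2)

theorem sqMap_smul {X : Type u} {Y : Type w} (f : X → Y) (g : Z2) (p : Sq X) :
    sqMap f (g • p) = g • sqMap f p := by
  rw [Sq.smul_def, Sq.smul_def]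
  by_cases h : g = 1
  · rw [if_pos h, if_pos h]
  · rw [if_neg h, if_neg h]
    rfl

/-- `f` is coarse expanding: `(x, y) ↦ (f x, f y)` is a relatively coarse map from
`(X², δ(X))` to `(Y², δ(Y))`. -/
def IsCoarseExpanding {X : Type u} {Y : Type w} [MetricSpace X] [MetricSpace Y]
    (f : X → Y) : Prop :=
  IsRelativelyCoarse (sqMap f) (delta X) (delta Y)

/-- The coarse cohomology of the configuration space of `X`: the `ℤ/2`-equivariant coarse
cohomology of the complement of `δ(X)` in `X²`. -/
abbrev ConfCohomology (X : Type u) [MetricSpace X] (R : Type v) [AddCommGroup R]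
    [DistribMulAction Z2 R] (n : ℕ) : Type (max u v) :=
  EqCoarseCohomology Z2 R (delta X) n

/-- The map on the coarse cohomology of configuration spaces induced by a coarse expanding map. -/
noncomputable def confMap {X : Type u} {Y : Type w} [MetricSpace X] [MetricSpace Y] (R : Type v)
    [AddCommGroup R] [DistribMulAction Z2 R] (f : X → Y) (hf : IsCoarseExpanding f) (n : ℕ) :
    ConfCohomology Y R n →+ ConfCohomology X R n :=
  eqCohomologyMap R (sqMap f) hf (sqMap_smul f) n

/-- The space `ℓ^∞` of bounded real sequences with the sup norm. -/
abbrev LInf : Type := lp (fun _ : ℕ => ℝ) ∞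

end CoarseConf

/-! Write a pair `(f x, f y)` as midpoint `m` plus or minus half difference `w`. The flip fixes `m`
and negates `w`, and distance to the diagonal is governed by `‖w‖` alone. So an equivariant homotopy
may move `m` freely, provided `w` stays odd and large wherever `x` and `y` are far apart.

The room in `ℓ^∞` allows this. Clamping kills the midpoint and cuts `w` down to finitely many
nonzero terms, at the cost of a factor 4 in norm (`norm_le_finiteTrunc`). The truncated half
differences `u` of `f` and `v` of `g` are both contained in their interleaving. That sequence can be
swept, one position after another, into `u` or into `v`; at every time each target term is visible
either at its old or at its new position, so the norm never drops below that of the target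
(`norm_le_sweep`). The result is a zigzag of homotopies from `f` to `g`.

Time is unbounded, but every point stops at a finite time. The prism operators of the single time
steps therefore add up to a pointwise finite sum, and uniform control in time makes this sum a
coarse cochain (`IsCoarseHomotopy.exists_coboundary_eq`). In degree `0` cocycles are constant. -/

namespace CoarseConf

/-! ### Prism operators and the cochain homotopy formula. -/

section Prism

variable {Y : Type u} {R : Type v} [AddCommGroup R]

/-- The simplex `(a₀, …, aᵢ, bᵢ, …, bₙ)` of the prism over two simplices `a` and `b`. -/
def prismSimplex {n : ℕ} (a b : Fin (n + 1) → Y) (i : Fin (n + 1)) : Fin (n + 2) → Y :=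
  fun k => if h : (k : ℕ) ≤ i then a ⟨k, by omega⟩ else b ⟨k - 1, by omega⟩

/-- The prism operator `φ ↦ ∑ᵢ (-1)ⁱ φ(a₀, …, aᵢ, bᵢ, …, bₙ)`. -/
def prism {n : ℕ} (φ : Cochain Y R (n + 1)) (a b : Fin (n + 1) → Y) : R :=
  ∑ i : Fin (n + 1), (-1 : ℤ) ^ (i : ℕ) • φ (prismSimplex a b i)

/-- The simplex `(a₀, …, aᵢ₋₁, bᵢ, …, bₙ)`. -/
def spliceSimplex {n : ℕ} (a b : Fin (n + 1) → Y) (i : ℕ) : Fin (n + 1) → Y :=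
  fun k => if (k : ℕ) < i then a k else b k

/-- Both sides enumerate the pairs `i ≠ j`: each is the full double sum minus its diagonal. -/
theorem sum_succAbove_comm {n : ℕ} (G : Fin (n + 1) → Fin (n + 1) → R) :
    ∑ i, ∑ m, G i (i.succAbove m) = ∑ j, ∑ m, G (Fin.succAbove j m) j := by
  have h1 : ∑ i, ∑ j, G i j = ∑ i, G i i + ∑ i, ∑ m, G i (i.succAbove m) := by
    rw [← Finset.sum_add_distrib]
    exact Finset.sum_congr rfl fun i _ => Fin.sum_univ_succAbove _ i
  have h2 : ∑ j, ∑ i, G i j = ∑ i, G i i + ∑ j, ∑ m, G (Fin.succAbove j m) j := by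
    rw [← Finset.sum_add_distrib]
    exact Finset.sum_congr rfl fun j _ => Fin.sum_univ_succAbove (fun i => G i j) j
  rw [Finset.sum_comm, h2] at h1
  exact (add_left_cancel h1).symm

theorem prismSimplex_face_self {n : ℕ} (a b : Fin (n + 1) → Y) (i : Fin (n + 1)) :
    (fun k => prismSimplex a b i (i.castSucc.succAbove k)) = spliceSimplex a b i := by
  funext k
  by_cases h : (k : ℕ) < i
  · have hk : i.castSucc.succAbove k = k.castSucc :=
      Fin.succAbove_of_castSucc_lt _ _ h
    simp [prismSimplex, spliceSimplex, hk, h, h.le]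
  · have hk : i.castSucc.succAbove k = k.succ :=
      Fin.succAbove_of_le_castSucc _ _ (not_lt.1 h)
    have : ¬ ((k : ℕ) + 1 ≤ i) := by omega
    simp [prismSimplex, spliceSimplex, hk, h, this]

theorem prismSimplex_face_succ {n : ℕ} (a b : Fin (n + 1) → Y) (i : Fin (n + 1)) :
    (fun k => prismSimplex a b i (i.succ.succAbove k)) = spliceSimplex a b (i + 1) := by
  funext k
  by_cases h : (k : ℕ) < i + 1
  · have hk : i.succ.succAbove k = k.castSucc :=
      Fin.succAbove_of_castSucc_lt _ _ h
    simp [prismSimplex, spliceSimplex, hk, h, Nat.le_of_lt_succ h]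
  · have hk : i.succ.succAbove k = k.succ :=
      Fin.succAbove_of_le_castSucc _ _ (not_lt.1 h)
    have : ¬ ((k : ℕ) + 1 ≤ i) := by omega
    simp [prismSimplex, spliceSimplex, hk, h, this]

/-- A prism simplex with index other than `j` contains exactly one of `a j` and `b j`; deleting that
vertex leaves a simplex of the prism over the `j`-th faces. -/
theorem prismSimplex_face_of_ne {n : ℕ} (a b : Fin (n + 2) → Y) (j : Fin (n + 2))
    (m : Fin (n + 1)) :
    (fun k => prismSimplex a b (j.succAbove m)
      ((j.succAbove m).castSucc.succAbove j |>.succAbove k)) =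
      prismSimplex (fun k => a (j.succAbove k)) (fun k => b (j.succAbove k)) m := by
  funext k
  have key : ∀ (c : Fin (n + 2) → Y) (x y : Fin (n + 2)), (x : ℕ) = y → c x = c y :=
    fun c x y h => congrArg c (Fin.ext h)
  by_cases h : m.castSucc < j
  · have h' : (m : ℕ) < j := h
    have hj : m.castSucc.castSucc.succAbove j = j.succ :=
      Fin.succAbove_of_le_castSucc _ _ h'.le
    rw [Fin.succAbove_of_castSucc_lt _ _ h, hj]
    simp only [prismSimplex, Fin.succAbove, Fin.lt_def, Fin.val_castSucc, Fin.val_succ]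
    rcases le_or_gt (k : ℕ) m with hk | hk
    · have h1 : (k : ℕ) < j + 1 := by omega
      have h2 : (k : ℕ) < j := by omega
      simp [hk, h1, h2]
    · have h1 : ¬ (k : ℕ) ≤ m := by omega
      by_cases h2 : (k : ℕ) < j + 1
      · have h3 : (k : ℕ) - 1 < j := by omega
        simp [h1, h2, h3]
      · have h3 : ¬ (k : ℕ) - 1 < j := by omega
        have h4 : ¬ (k : ℕ) + 1 ≤ m := by omega
        simp only [h1, h2, h3, h4, if_false, dite_false, Fin.val_succ]
        exact key _ _ _ (by simp only [Fin.val_succ]; omega)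
  · have h' : (j : ℕ) ≤ m := not_lt.1 h
    have hj : m.succ.castSucc.succAbove j = j.castSucc :=
      Fin.succAbove_of_castSucc_lt _ _ (Nat.lt_succ_of_le h')
    rw [Fin.succAbove_of_le_castSucc _ _ (not_lt.1 h), hj]
    simp only [prismSimplex, Fin.succAbove, Fin.lt_def, Fin.val_castSucc, Fin.val_succ]
    rcases le_or_gt (k : ℕ) m with hk | hk
    · by_cases h2 : (k : ℕ) < j
      · have h3 : (k : ℕ) ≤ m + 1 := by omega
        simp [hk, h2, h3]
      · simp [hk, h2]
    · have h1 : ¬ (k : ℕ) ≤ m := by omega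
      have h2 : ¬ (k : ℕ) < j := by omega
      have h3 : ¬ (k : ℕ) - 1 < j := by omega
      have h4 : ¬ (k : ℕ) + 1 ≤ m + 1 := by omega
      simp only [h1, h2, h3, h4, if_false, dite_false, Fin.val_succ]
      exact key _ _ _ (by simp only [Fin.val_succ]; omega)

theorem neg_one_pow_prism {n : ℕ} (j : Fin (n + 2)) (m : Fin (n + 1)) :
    (-1 : ℤ) ^ ((j.succAbove m : Fin (n + 2)) : ℕ) *
      (-1 : ℤ) ^ (((j.succAbove m).castSucc.succAbove j : Fin (n + 3)) : ℕ) =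
      -((-1 : ℤ) ^ (j : ℕ) * (-1 : ℤ) ^ (m : ℕ)) := by
  simp only [Fin.succAbove, Fin.lt_def, Fin.val_castSucc]
  split_ifs <;> simp_all [pow_succ, mul_comm]
  omega

/-- The two internal faces of each prism simplex are spliced simplices, which telescope to the top
and the bottom. The remaining faces cancel against the prisms over the faces of `a` and `b`. -/
theorem sum_coboundary_prismSimplex {n : ℕ} (φ : Cochain Y R (n + 1)) (a b : Fin (n + 2) → Y) :
    ∑ i : Fin (n + 2), (-1 : ℤ) ^ (i : ℕ) • coboundary Y R (n + 1) φ (prismSimplex a b i) +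
      ∑ j : Fin (n + 2), (-1 : ℤ) ^ (j : ℕ) •
        prism φ (fun k => a (j.succAbove k)) (fun k => b (j.succAbove k)) = φ b - φ a := by
  -- All faces of the `i`-th prism simplex except number `i.castSucc` are indexed by `j`: the value
  -- `j = i` gives the other internal face `i.succ`, and `j ≠ i` deletes the vertex over `j`.
  let G : Fin (n + 2) → Fin (n + 2) → R := fun i j =>
    ((-1 : ℤ) ^ (i : ℕ) * (-1 : ℤ) ^ ((i.castSucc.succAbove j : Fin (n + 3)) : ℕ)) •
      φ (fun k => prismSimplex a b i ((i.castSucc.succAbove j).succAbove k))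
  have h1 : ∀ i : Fin (n + 2),
      (-1 : ℤ) ^ (i : ℕ) • coboundary Y R (n + 1) φ (prismSimplex a b i) =
        (φ (spliceSimplex a b i) - φ (spliceSimplex a b (i + 1))) +
          ∑ m, G i (i.succAbove m) := by
    intro i
    have hi : i.castSucc.succAbove i = i.succ := Fin.succAbove_of_le_castSucc _ _ le_rfl
    rw [coboundary_apply, Finset.smul_sum, Fin.sum_univ_succAbove _ i.castSucc,
      Fin.sum_univ_succAbove _ i, ← add_assoc, hi, prismSimplex_face_self,
      prismSimplex_face_succ]
    congr 1
    · rw [smul_smul, smul_smul, Fin.val_castSucc, Fin.val_succ, ← pow_add, ← pow_add,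
        ← add_assoc, pow_succ, Even.neg_one_pow ⟨_, rfl⟩]
      simp [sub_eq_add_neg]
    · exact Finset.sum_congr rfl fun m _ => smul_smul _ _ _
  have h2 : ∀ j : Fin (n + 2), (-1 : ℤ) ^ (j : ℕ) •
      prism φ (fun k => a (j.succAbove k)) (fun k => b (j.succAbove k)) =
        - ∑ m, G (j.succAbove m) j := by
    intro j
    rw [prism, Finset.smul_sum, ← Finset.sum_neg_distrib]
    refine Finset.sum_congr rfl fun m _ => ?_
    simp only [G, prismSimplex_face_of_ne, neg_one_pow_prism, neg_smul, neg_neg, smul_smul]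
  have h3 : ∑ i : Fin (n + 2),
      (φ (spliceSimplex a b i) - φ (spliceSimplex a b (i + 1))) = φ b - φ a := by
    rw [Fin.sum_univ_eq_sum_range
      (fun i => φ (spliceSimplex a b i) - φ (spliceSimplex a b (i + 1))),
      Finset.sum_range_sub']
    have hb : spliceSimplex a b 0 = b := by
      funext k
      simp [spliceSimplex]
    have ha : spliceSimplex a b (n + 2) = a := by
      funext k
      simp [spliceSimplex]
    rw [hb, ha]
  rw [Finset.sum_congr rfl fun i _ => h1 i, Finset.sum_congr rfl fun j _ => h2 j,
    Finset.sum_add_distrib, h3, sum_succAbove_comm, Finset.sum_neg_distrib]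
  abel

theorem sum_prism_face_of_cocycle {n : ℕ} {φ : Cochain Y R (n + 1)}
    (hφ : coboundary Y R (n + 1) φ = 0) (a b : Fin (n + 2) → Y) :
    ∑ j : Fin (n + 2), (-1 : ℤ) ^ (j : ℕ) •
      prism φ (fun k => a (j.succAbove k)) (fun k => b (j.succAbove k)) = φ b - φ a := by
  simpa [hφ] using sum_coboundary_prismSimplex φ a b

variable {X : Type w} {G : Type*} [Group G]

/-- The contribution of the time interval `[t, t + 1]` to the cochain homotopy; subtracting the
degenerate prism makes it vanish where `H t` and `H (t + 1)` agree. -/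
def homotopyStep (H : ℕ → X → Y) {n : ℕ} (φ : Cochain Y R (n + 1)) (t : ℕ) : Cochain X R n :=
  fun σ => prism φ (fun i => H t (σ i)) (fun i => H (t + 1) (σ i)) -
    prism φ (fun i => H t (σ i)) (fun i => H t (σ i))

theorem coboundary_homotopyStep (H : ℕ → X → Y) {n : ℕ} {φ : Cochain Y R (n + 1)}
    (hφ : coboundary Y R (n + 1) φ = 0) (t : ℕ) (σ : Fin (n + 2) → X) :
    coboundary X R n (homotopyStep H φ t) σ =
      φ (fun i => H (t + 1) (σ i)) - φ (fun i => H t (σ i)) := by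
  simp only [coboundary_apply, homotopyStep, smul_sub, Finset.sum_sub_distrib]
  rw [sum_prism_face_of_cocycle hφ (fun i => H t (σ i)) (fun i => H (t + 1) (σ i)),
    sum_prism_face_of_cocycle hφ (fun i => H t (σ i)) (fun i => H t (σ i)), sub_self, sub_zero]

theorem prismSimplex_smul {n : ℕ} [MulAction G Y] (c : G) (a b : Fin (n + 1) → Y)
    (i : Fin (n + 1)) :
    prismSimplex (fun k => c • a k) (fun k => c • b k) i =
      fun k => c • prismSimplex a b i k := by
  funext k
  simp only [prismSimplex]
  split_ifs <;> rfl

theorem prism_smul [MulAction G Y] [DistribMulAction G R] {n : ℕ} {φ : Cochain Y R (n + 1)}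
    (hφ : ∀ (c : G) (σ : Fin (n + 2) → Y), φ (fun i => c • σ i) = c • φ σ) (c : G)
    (a b : Fin (n + 1) → Y) :
    prism φ (fun k => c • a k) (fun k => c • b k) = c • prism φ a b := by
  simp only [prism, prismSimplex_smul, hφ, Finset.smul_sum]
  exact Finset.sum_congr rfl fun i _ =>
    (map_zsmul (DistribSMul.toAddMonoidHom R c) _ _).symm

theorem exists_of_prism_ne_zero {n : ℕ} {φ : Cochain Y R (n + 1)} {a b : Fin (n + 1) → Y}
    (h : prism φ a b ≠ 0) : ∃ i, φ (prismSimplex a b i) ≠ 0 := by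
  obtain ⟨i, -, hi⟩ := Finset.exists_ne_zero_of_sum_ne_zero h
  exact ⟨i, fun h0 => hi (by rw [h0, smul_zero])⟩

end Prism

/-! ### Coarse homotopies in discrete time and their effect on cocycles. -/

section Homotopy

variable {X : Type u} [MetricSpace X] {Y : Type w} [MetricSpace Y] {G : Type*} [Group G]
  [MulAction G X] [MulAction G Y]

/-- A coarse homotopy of maps `(X, A) → (Y, B)` in discrete time, which is stationary from some
time on at each point of `X`. -/
structure IsCoarseHomotopy (G : Type*) [Group G] [MulAction G X] [MulAction G Y]
    (A : Set X) (B : Set Y) (H : ℕ → X → Y) (f g : X → Y) : Prop where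
  zero : H 0 = f
  eventually_eq : ∀ x, ∃ T, ∀ t, T ≤ t → H t x = g x
  smul : ∀ t (c : G) x, H t (c • x) = c • H t x
  step : ∃ C : ℝ, ∀ t x, dist (H t x) (H (t + 1) x) ≤ C
  bornologous : ∀ r : ℝ, ∃ C : ℝ, ∀ t x y, dist x y ≤ r → dist (H t x) (H t y) ≤ C
  proper : ∀ r : ℝ, ∃ s : ℝ, ∀ t x, (∃ b ∈ B, dist (H t x) b ≤ r) → ∃ a ∈ A, dist x a ≤ s

/-- Every vertex of the prism lies within `D` of some vertex of `a`. -/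
theorem dist_prismSimplex_le {n : ℕ} {a b : Fin (n + 1) → Y} {C D : ℝ}
    (ha : ∀ i j, dist (a i) (a j) ≤ C) (hab : ∀ i, dist (a i) (b i) ≤ D) (i : Fin (n + 1))
    (k l : Fin (n + 2)) : dist (prismSimplex a b i k) (prismSimplex a b i l) ≤ D + C + D := by
  have hD : 0 ≤ D := dist_nonneg.trans (hab 0)
  have key : ∀ k, ∃ j, dist (prismSimplex a b i k) (a j) ≤ D := by
    intro k
    simp only [prismSimplex]
    split_ifs with h
    · exact ⟨_, by rw [dist_self]; exact hD⟩
    · exact ⟨_, by rw [dist_comm]; exact hab _⟩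
  obtain ⟨p, hp⟩ := key k
  obtain ⟨q, hq⟩ := key l
  have := dist_triangle4_right (prismSimplex a b i k) (prismSimplex a b i l) (a p) (a q)
  linarith [ha p q]

variable {R : Type v} [AddCommGroup R] {A : Set X} {B : Set Y} {H : ℕ → X → Y} {f g : X → Y}

/-- Homotopic maps pull a cocycle back to cohomologous cocycles. -/
theorem IsCoarseHomotopy.exists_coboundary_eq [DistribMulAction G R]
    (hH : IsCoarseHomotopy G A B H f g) {n : ℕ} {φ : Cochain Y R (n + 1)}
    (hφ : φ ∈ eqCoarseCochain G R B (n + 1)) (hd : coboundary Y R (n + 1) φ = 0) :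
    ∃ ψ ∈ eqCoarseCochain G R A n, coboundary X R n ψ =
      fun σ => φ (fun i => g (σ i)) - φ (fun i => f (σ i)) := by
  obtain ⟨hcoarse, hequiv⟩ := hφ
  choose T hT using hH.eventually_eq
  -- A time by which all vertices of `σ` have stopped; it bounds the sum defining `ψ σ`.
  let N : {n : ℕ} → (Fin (n + 1) → X) → ℕ := fun σ => Finset.univ.sup fun i => T (σ i)
  have hN : ∀ {n : ℕ} (σ : Fin (n + 1) → X) (t : ℕ), N σ ≤ t → ∀ i, H t (σ i) = g (σ i) :=
    fun σ t ht i => hT _ _ ((Finset.le_sup (f := fun i => T (σ i)) (Finset.mem_univ i)).trans ht)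
  let ψ : Cochain X R n := fun σ => ∑ t ∈ Finset.range (N σ), homotopyStep H φ t σ
  -- After `N σ` the prism equals the degenerate one subtracted from it, so a simplex, its faces and
  -- its translates can share one cutoff.
  have hψ : ∀ σ M, N σ ≤ M → ψ σ = ∑ t ∈ Finset.range M, homotopyStep H φ t σ := by
    intro σ M hM
    refine Finset.sum_subset (Finset.range_mono hM) fun t _ ht => ?_
    have ht' : N σ ≤ t := by simpa using ht
    simp only [homotopyStep, hN σ t ht', hN σ (t + 1) (by omega), sub_self]
  refine ⟨ψ, ⟨(isCoarseCochain_iff _ _).2 fun r hr => ?_, fun c σ => ?_⟩, ?_⟩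
  · obtain ⟨D, hD⟩ := hH.step
    obtain ⟨C, hC⟩ := hH.bornologous r
    rw [isCoarseCochain_iff] at hcoarse
    -- The first entry bounds the diameter of the simplices in a genuine prism, the second that of
    -- the simplices in a degenerate one, and the second is nonnegative as required.
    obtain ⟨p, -, hp⟩ := hcoarse (max (D + C + D) (max C 0 + max C 0))
      (le_max_of_le_right (by positivity))
    obtain ⟨s, hs⟩ := hH.proper p
    refine ⟨max (r + s) 0, le_max_right _ _, fun σ hσ hdist => ?_⟩
    obtain ⟨t, -, ht⟩ := Finset.exists_ne_zero_of_sum_ne_zero hσ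
    have ha : ∀ i j, dist (H t (σ i)) (H t (σ j)) ≤ C := fun i j => hC t _ _ (hdist i j)
    have main : ∃ b ∈ B, dist (H t (σ 0)) b ≤ p := by
      by_cases h0 : prism φ (fun i => H t (σ i)) (fun i => H t (σ i)) = 0
      · have h1 : prism φ (fun i => H t (σ i)) (fun i => H (t + 1) (σ i)) ≠ 0 := fun h1 =>
          ht (by simp only [homotopyStep, h0, h1, sub_self])
        obtain ⟨i, hi⟩ := exists_of_prism_ne_zero h1
        obtain ⟨b, hb, hbp⟩ := hp _ hi fun k l =>
          -- Vertex `0` of every prism simplex is `H t (σ 0)`, so `hbp 0` puts this point near `B`.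
          (dist_prismSimplex_le ha (fun i => hD t (σ i)) i k l).trans (le_max_left _ _)
        exact ⟨b, hb, hbp 0⟩
      · obtain ⟨i, hi⟩ := exists_of_prism_ne_zero h0
        obtain ⟨b, hb, hbp⟩ := hp _ hi fun k l =>
          (dist_prismSimplex_le ha (D := 0) (fun i => (dist_self _).le) i k l).trans
            (le_max_of_le_right (by
              have := le_max_left C 0
              have := le_max_right C 0
              linarith))
        exact ⟨b, hb, hbp 0⟩
    obtain ⟨a, haA, has⟩ := hs t _ main
    refine ⟨a, haA, fun i => le_max_of_le_left ?_⟩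
    have := dist_triangle (σ i) (σ 0) a
    linarith [hdist i 0]
  · rw [hψ _ (max (N σ) (N fun i => c • σ i)) (le_max_right _ _),
      hψ σ (max (N σ) (N fun i => c • σ i)) (le_max_left _ _), Finset.smul_sum]
    refine Finset.sum_congr rfl fun t _ => ?_
    simp only [homotopyStep, hH.smul, prism_smul hequiv, smul_sub]
  · funext σ
    have hface : ∀ j : Fin (n + 2), N (fun k => σ (j.succAbove k)) ≤ N σ := fun j =>
      Finset.sup_le fun k _ =>
        Finset.le_sup (f := fun i => T (σ i)) (Finset.mem_univ (j.succAbove k))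
    have h1 : coboundary X R n ψ σ =
        ∑ t ∈ Finset.range (N σ), coboundary X R n (homotopyStep H φ t) σ := by
      simp only [coboundary_apply]
      rw [Finset.sum_comm]
      refine Finset.sum_congr rfl fun j _ => ?_
      rw [hψ _ _ (hface j), Finset.smul_sum]
    rw [h1, Finset.sum_congr rfl fun t _ => coboundary_homotopyStep H hd t σ,
      Finset.sum_range_sub (fun t => φ fun i => H t (σ i))]
    simp only [hN σ _ le_rfl, hH.zero]

end Homotopy

/-! ### Clamping real numbers -/

/-- The nearest point to `a` in the interval `[-r, r]`, or `0` if `r` is negative. -/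
noncomputable def clampAt (r a : ℝ) : ℝ := max (-(max r 0)) (min (max r 0) a)

theorem clampAt_neg (r a : ℝ) : clampAt r (-a) = -clampAt r a := by
  have h : (0 : ℝ) ≤ max r 0 := le_max_right _ _
  simp only [clampAt]
  generalize max r 0 = s at h
  grind

theorem clampAt_of_nonpos {r : ℝ} (h : r ≤ 0) (a : ℝ) : clampAt r a = 0 := by
  rw [clampAt, max_eq_right h, neg_zero]
  exact max_eq_left (min_le_left _ _)

theorem clampAt_zero (r : ℝ) : clampAt r 0 = 0 := by
  have h : (0 : ℝ) ≤ max r 0 := le_max_right _ _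
  rw [clampAt, min_eq_right h, max_eq_right (neg_nonpos.2 h)]

theorem abs_clampAt (r a : ℝ) : |clampAt r a| = min (max r 0) |a| := by
  have h : (0 : ℝ) ≤ max r 0 := le_max_right _ _
  simp only [clampAt]
  generalize max r 0 = s at h
  grind

theorem clampAt_of_abs_le {r a : ℝ} (h : |a| ≤ r) : clampAt r a = a := by
  obtain ⟨h1, h2⟩ := abs_le.1 h
  rw [clampAt, max_eq_left ((abs_nonneg a).trans h), min_eq_right h2, max_eq_right h1]

/-- Clamping is built from `max` and `min`, hence is 1-Lipschitz jointly in radius and value.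
Changing radii at bounded speed thus moves sequences at bounded speed. -/
theorem abs_clampAt_sub_clampAt_le {r s a b C : ℝ} (hr : |r - s| ≤ C) (ha : |a - b| ≤ C) :
    |clampAt r a - clampAt s b| ≤ C := by
  have h : |max r 0 - max s 0| ≤ C := (abs_max_sub_max_le_abs r s 0).trans hr
  refine (abs_max_sub_max_le_max _ _ _ _).trans (max_le ?_ ?_)
  · rwa [neg_sub_neg, abs_sub_comm]
  · exact (abs_min_sub_min_le_max _ _ _ _).trans (max_le h ha)

/-! ### Bounded sequences -/

namespace LInf

theorem abs_apply_le (a : LInf) (k : ℕ) : |a k| ≤ ‖a‖ :=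
  lp.norm_apply_le_norm ENNReal.top_ne_zero a k

theorem norm_le {a : LInf} {C : ℝ} (h : ∀ k, |a k| ≤ C) : ‖a‖ ≤ C :=
  lp.norm_le_of_forall_le' C h

theorem norm_sub_le {a b : LInf} {C : ℝ} (h : ∀ k, |a k - b k| ≤ C) : ‖a - b‖ ≤ C :=
  norm_le h

theorem abs_sub_apply_le (a b : LInf) (k : ℕ) : |a k - b k| ≤ ‖a - b‖ :=
  abs_apply_le (a - b) k

theorem neg_apply (a : LInf) (k : ℕ) : (-a) k = -a k := rfl

theorem exists_lt_abs_apply {a : LInf} {C : ℝ} (h : C < ‖a‖) : ∃ k, C < |a k| := by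
  by_contra! hk
  exact h.not_ge (norm_le hk)

/-- The bounded sequence with given terms. -/
def ofBound (a : ℕ → ℝ) (C : ℝ) (h : ∀ k, |a k| ≤ C) : LInf :=
  ⟨a, memℓp_infty ⟨C, by rintro _ ⟨k, rfl⟩; exact h k⟩⟩

/-- The sequence `a` with its `k`-th term clamped to `[-rₖ, rₖ]`. -/
noncomputable def clamp (r : ℕ → ℝ) (a : LInf) : LInf :=
  ofBound (fun k => clampAt (r k) (a k)) ‖a‖ fun k => by
    rw [abs_clampAt]
    exact (min_le_right _ _).trans (abs_apply_le a k)

theorem clamp_apply (r : ℕ → ℝ) (a : LInf) (k : ℕ) : clamp r a k = clampAt (r k) (a k) := rfl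

theorem clamp_neg (r : ℕ → ℝ) (a : LInf) : clamp r (-a) = -clamp r a :=
  lp.ext (funext fun k => clampAt_neg (r k) (a k))

theorem norm_clamp_sub_clamp_le {r s : ℕ → ℝ} {a b : LInf} {C : ℝ} (hr : ∀ k, |r k - s k| ≤ C)
    (ha : ‖a - b‖ ≤ C) : ‖clamp r a - clamp s b‖ ≤ C :=
  norm_sub_le fun k => abs_clampAt_sub_clampAt_le (hr k) ((abs_sub_apply_le a b k).trans ha)

theorem norm_clamp_le_norm_clamp {r s : ℕ → ℝ} (h : ∀ k, r k ≤ s k) (a : LInf) :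
    ‖clamp r a‖ ≤ ‖clamp s a‖ := by
  refine norm_le fun k => le_trans ?_ (abs_apply_le (clamp s a) k)
  rw [clamp_apply, clamp_apply, abs_clampAt, abs_clampAt]
  exact min_le_min_right _ (max_le_max_right _ (h k))

theorem clamp_eq_self {r : ℕ → ℝ} {a : LInf} (h : ∀ k, ‖a‖ ≤ r k) : clamp r a = a :=
  lp.ext (funext fun k => clampAt_of_abs_le ((abs_apply_le a k).trans (h k)))

theorem clamp_eq_zero {r : ℕ → ℝ} (h : ∀ k, r k ≤ 0) (a : LInf) : clamp r a = 0 :=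
  lp.ext (funext fun k => clampAt_of_nonpos (h k) (a k))

/-! ### Finitely supported truncation -/

/-- The maximum of `|aⱼ|` over `j < k`. -/
noncomputable def headMax (a : LInf) (k : ℕ) : ℝ :=
  -- Taking the supremum in `ℝ≥0` makes it `0` for `k = 0`.
  ((Finset.range k).sup fun j => ‖a j‖₊ : ℝ≥0)

theorem le_headMax (a : LInf) {j k : ℕ} (h : j < k) : |a j| ≤ headMax a k := by
  have := Finset.le_sup (f := fun j => ‖a j‖₊) (Finset.mem_range.2 h)
  exact_mod_cast this

theorem headMax_le {a : LInf} {k : ℕ} {C : ℝ} (hC : 0 ≤ C) (h : ∀ j < k, |a j| ≤ C) :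
    headMax a k ≤ C := by
  have : ((Finset.range k).sup fun j => ‖a j‖₊ : ℝ≥0) ≤ ⟨C, hC⟩ :=
    Finset.sup_le fun j hj => h j (Finset.mem_range.1 hj)
  exact_mod_cast this

theorem headMax_nonneg (a : LInf) (k : ℕ) : 0 ≤ headMax a k := NNReal.coe_nonneg _

theorem headMax_le_norm (a : LInf) (k : ℕ) : headMax a k ≤ ‖a‖ :=
  headMax_le (norm_nonneg a) fun j _ => abs_apply_le a j

theorem headMax_neg (a : LInf) (k : ℕ) : headMax (-a) k = headMax a k := by
  simp only [headMax, neg_apply, nnnorm_neg]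

theorem headMax_le_add (a b : LInf) (k : ℕ) : headMax a k ≤ headMax b k + ‖a - b‖ := by
  refine headMax_le (add_nonneg (headMax_nonneg b k) (norm_nonneg _)) fun j hj => ?_
  have h := abs_sub_abs_le_abs_sub (a j) (b j)
  linarith [le_headMax b hj, abs_sub_apply_le a b j]

/-- The radii at which the terms of `a` are cut off in `finiteTrunc`. They vanish beyond a term of
absolute value at least `‖a‖ / 2`. -/
noncomputable def cutRadius (a : LInf) (k : ℕ) : ℝ := ‖a‖ - 2 * headMax a k

theorem cutRadius_neg (a : LInf) : cutRadius (-a) = cutRadius a := by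
  funext k
  rw [cutRadius, cutRadius, norm_neg, headMax_neg]

/-- The constant is `1` from the norm plus `2` from the doubled `headMax`. -/
theorem abs_cutRadius_sub_le (a b : LInf) (k : ℕ) :
    |cutRadius a k - cutRadius b k| ≤ 3 * ‖a - b‖ := by
  have h1 := headMax_le_add a b k
  have h2 := headMax_le_add b a k
  rw [norm_sub_rev] at h2
  have h3 := abs_le.1 (abs_norm_sub_norm_le a b)
  rw [cutRadius, cutRadius, abs_le]
  constructor <;> linarith

/-- A finitely supported truncation of `a`, with norm comparable to that of `a`. -/
noncomputable def finiteTrunc (a : LInf) : LInf := clamp (cutRadius a) a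

theorem finiteTrunc_neg (a : LInf) : finiteTrunc (-a) = -finiteTrunc a := by
  rw [finiteTrunc, cutRadius_neg, clamp_neg, finiteTrunc]

theorem norm_finiteTrunc_sub_le (a b : LInf) :
    ‖finiteTrunc a - finiteTrunc b‖ ≤ 3 * ‖a - b‖ :=
  norm_clamp_sub_clamp_le (abs_cutRadius_sub_le a b) (by linarith [norm_nonneg (a - b)])

/-- At the first term exceeding `‖a‖ / 4` in absolute value, all earlier terms are at most `‖a‖ /
4`, so the cut radius there is still at least `‖a‖ / 2`. -/
theorem norm_le_finiteTrunc (a : LInf) : ‖a‖ ≤ 4 * ‖finiteTrunc a‖ := by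
  rcases (norm_nonneg a).eq_or_lt with h | h
  · rw [← h]
    positivity
  · have hex : ∃ k, ‖a‖ / 4 < |a k| := exists_lt_abs_apply (by linarith)
    classical
    have hk := Nat.find_spec hex
    have hmin : headMax a (Nat.find hex) ≤ ‖a‖ / 4 :=
      headMax_le (by linarith) fun j hj => not_lt.1 (Nat.find_min hex hj)
    have h1 := abs_apply_le (finiteTrunc a) (Nat.find hex)
    rw [finiteTrunc, clamp_apply, abs_clampAt, ← finiteTrunc] at h1
    have h2 : ‖a‖ / 4 ≤ min (max (cutRadius a (Nat.find hex)) 0) |a (Nat.find hex)| :=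
      le_min (le_max_of_le_left (by rw [cutRadius]; linarith)) hk.le
    linarith

theorem exists_finiteTrunc_apply_eq_zero (a : LInf) :
    ∃ K, ∀ k, K ≤ k → finiteTrunc a k = 0 := by
  rcases (norm_nonneg a).eq_or_lt with h | h
  · refine ⟨0, fun k _ => clampAt_of_nonpos ?_ _⟩
    rw [cutRadius]
    linarith [headMax_nonneg a k]
  · obtain ⟨j, hj⟩ : ∃ k, ‖a‖ / 2 < |a k| := exists_lt_abs_apply (by linarith)
    refine ⟨j + 1, fun k hk => clampAt_of_nonpos ?_ _⟩
    rw [cutRadius]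
    linarith [le_headMax a (Nat.lt_of_succ_le hk)]

/-! ### Interleaving and sweeping -/

/-- The sequence `(a₀, b₀, a₁, b₁, …)`. -/
noncomputable def interleave (a b : LInf) : LInf :=
  ofBound (fun k => if Even k then a (k / 2) else b (k / 2)) (max ‖a‖ ‖b‖) fun k => by
    split_ifs
    · exact le_max_of_le_left (abs_apply_le a _)
    · exact le_max_of_le_right (abs_apply_le b _)

theorem interleave_apply (a b : LInf) (k : ℕ) :
    interleave a b k = if Even k then a (k / 2) else b (k / 2) := rfl

theorem interleave_neg (a b : LInf) : interleave (-a) (-b) = -interleave a b := by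
  refine lp.ext (funext fun k => ?_)
  rw [neg_apply, interleave_apply, interleave_apply]
  split_ifs <;> rfl

theorem norm_interleave_sub_le (a b a' b' : LInf) :
    ‖interleave a b - interleave a' b'‖ ≤ max ‖a - a'‖ ‖b - b'‖ := by
  refine norm_sub_le fun k => ?_
  rw [interleave_apply, interleave_apply]
  split_ifs
  · exact le_max_of_le_left (abs_sub_apply_le a a' _)
  · exact le_max_of_le_right (abs_sub_apply_le b b' _)

/-- The state at time `t` of a motion from `u` to `w` during which the `k`-th term is replaced
long before the `(k + 1)`-st one. -/
noncomputable def sweep (t : ℝ) (u w : LInf) : LInf :=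
  -- Term `k` starts to move at time `3 ^ k * ‖u‖`. If `‖w‖ ≤ ‖u‖`, it has at most `2 * ‖u‖` to
  -- travel and arrives by time `3 ^ (k + 1) * ‖u‖`, when term `k + 1` starts.
  u + clamp (fun k => t * (1 / 3) ^ k - ‖u‖) (w - u)

theorem sweep_apply (t : ℝ) (u w : LInf) (k : ℕ) :
    sweep t u w k = u k + clampAt (t * (1 / 3) ^ k - ‖u‖) (w k - u k) := rfl

theorem sweep_neg (t : ℝ) (u w : LInf) : sweep t (-u) (-w) = -sweep t u w := by
  rw [sweep, sweep, norm_neg, show -w - -u = -(w - u) by abel, clamp_neg, neg_add]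

theorem sweep_zero (u w : LInf) : sweep 0 u w = u := by
  rw [sweep, clamp_eq_zero (fun k => by simp), add_zero]

theorem norm_sweep_sub_le (t : ℝ) (u w u' w' : LInf) :
    ‖sweep t u w - sweep t u' w'‖ ≤ 2 * ‖u - u'‖ + ‖w - w'‖ := by
  have h : ‖clamp (fun k => t * (1 / 3) ^ k - ‖u‖) (w - u) -
      clamp (fun k => t * (1 / 3) ^ k - ‖u'‖) (w' - u')‖ ≤ ‖u - u'‖ + ‖w - w'‖ := by
    refine norm_clamp_sub_clamp_le (fun k => ?_) ?_
    -- The time-dependent parts of the radii cancel, so the bound is uniform in `t`.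
    · rw [sub_sub_sub_cancel_left, abs_sub_comm]
      exact (abs_norm_sub_norm_le u u').trans (le_add_of_nonneg_right (norm_nonneg _))
    · rw [sub_sub_sub_comm, add_comm]
      exact _root_.norm_sub_le _ _
  rw [sweep, sweep, add_sub_add_comm]
  refine (norm_add_le _ _).trans ?_
  linarith

theorem norm_sweep_sub_sweep_succ_le (t : ℝ) (u w : LInf) :
    ‖sweep t u w - sweep (t + 1) u w‖ ≤ 1 := by
  rw [sweep, sweep, add_sub_add_left_eq_sub]
  refine norm_clamp_sub_clamp_le (fun k => ?_) (by simp)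
  rw [show t * (1 / 3) ^ k - ‖u‖ - ((t + 1) * (1 / 3) ^ k - ‖u‖) = -(1 / 3 : ℝ) ^ k by ring,
    abs_neg, abs_of_nonneg (by positivity)]
  exact pow_le_one₀ (by norm_num) (by norm_num)

theorem norm_le_of_forall_exists_eq {u w : LInf} (h : ∀ k, ∃ j, k ≤ j ∧ u j = w k) :
    ‖w‖ ≤ ‖u‖ :=
  norm_le fun k => by
    obtain ⟨j, -, hj⟩ := h k
    rw [← hj]
    exact abs_apply_le u j

theorem sweep_apply_of_le {t : ℝ} {u w : LInf} (h : ‖w‖ ≤ ‖u‖) {k : ℕ}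
    (ht : 3 * ‖u‖ ≤ t * (1 / 3) ^ k) : sweep t u w k = w k := by
  rw [sweep_apply, clampAt_of_abs_le, add_sub_cancel]
  linarith [abs_sub (w k) (u k), abs_apply_le w k, abs_apply_le u k]

/-- The value `w k` is always visible. If `j = k`, that position never moves. If `k < j`, either
position `k` has already arrived at `w k`, or position `j` has not yet left `u j = w k`. -/
theorem norm_le_sweep {t : ℝ} (ht : 0 ≤ t) {u w : LInf} (h : ∀ k, ∃ j, k ≤ j ∧ u j = w k) :
    ‖w‖ ≤ ‖sweep t u w‖ := by
  refine norm_le fun k => ?_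
  obtain ⟨j, hkj, hj⟩ := h k
  rcases hkj.eq_or_lt with rfl | hlt
  · have := abs_apply_le (sweep t u w) k
    rwa [sweep_apply, hj, sub_self, clampAt_zero, add_zero] at this
  · rcases le_or_gt (3 * ‖u‖) (t * (1 / 3) ^ k) with hk | hk
    · have := abs_apply_le (sweep t u w) k
      rwa [sweep_apply_of_le (norm_le_of_forall_exists_eq h) hk] at this
    · have hpow : t * (1 / 3 : ℝ) ^ j ≤ t * (1 / 3) ^ (k + 1) :=
        mul_le_mul_of_nonneg_left
          (pow_le_pow_of_le_one (by norm_num) (by norm_num) hlt) ht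
      have := abs_apply_le (sweep t u w) j
      rwa [sweep_apply, clampAt_of_nonpos, add_zero, hj] at this
      rw [pow_succ] at hpow
      linarith

/-- Arrival times grow like `3 ^ k`, so stopping at a finite time relies on only finitely many
positions moving. This is what truncation is for. -/
theorem exists_sweep_eq {u w : LInf} (h : ∀ k, ∃ j, k ≤ j ∧ u j = w k)
    (hu : ∃ K, ∀ k, K ≤ k → u k = 0) (hw : ∃ K, ∀ k, K ≤ k → w k = 0) :
    ∃ T : ℕ, ∀ t : ℕ, T ≤ t → sweep t u w = w := by
  obtain ⟨K, hK⟩ := hu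
  obtain ⟨L, hL⟩ := hw
  obtain ⟨T, hT⟩ := exists_nat_ge (3 * ‖u‖ * 3 ^ max K L)
  refine ⟨T, fun t ht => lp.ext (funext fun k => ?_)⟩
  rcases le_total (max K L) k with hk | hk
  · rw [sweep_apply, hK k ((le_max_left _ _).trans hk), hL k ((le_max_right _ _).trans hk),
      sub_self, clampAt_zero, add_zero]
  · refine sweep_apply_of_le (norm_le_of_forall_exists_eq h) ?_
    have h1 : (3 : ℝ) ^ k ≤ 3 ^ max K L := pow_le_pow_right₀ (by norm_num) hk
    have h2 : (T : ℝ) ≤ t := by exact_mod_cast ht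
    rw [one_div, inv_pow, ← div_eq_mul_inv, le_div_iff₀ (by positivity)]
    exact (mul_le_mul_of_nonneg_left h1 (by positivity)).trans (hT.trans h2)

end LInf

/-! ### Homotopies of maps to the configuration space of `ℓ^∞` -/

/-- The point of `(ℓ^∞)²` with midpoint `m` and half difference `w`. -/
noncomputable def symmPair (m w : LInf) : Sq LInf := (m + w, m - w)

theorem dist_symmPair_le (m w m' w' : LInf) :
    dist (symmPair m w) (symmPair m' w') ≤ ‖m - m'‖ + ‖w - w'‖ := by
  refine max_le ?_ ?_
  · rw [dist_eq_norm]
    change ‖m + w - (m' + w')‖ ≤ _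
    rw [add_sub_add_comm]
    exact norm_add_le _ _
  · rw [dist_eq_norm]
    change ‖m - w - (m' - w')‖ ≤ _
    rw [sub_sub_sub_comm]
    exact norm_sub_le _ _

theorem norm_le_of_dist_symmPair_le {m w : LInf} {b : Sq LInf} (hb : b ∈ delta LInf) {r : ℝ}
    (h : dist (symmPair m w) b ≤ r) : ‖w‖ ≤ r := by
  have hb' : b.1 = b.2 := hb
  have h1 : ‖m + w - b.1‖ ≤ r := by
    rw [← dist_eq_norm]
    exact (le_max_left _ _).trans h
  have h2 : ‖m - w - b.2‖ ≤ r := by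
    rw [← dist_eq_norm]
    exact (le_max_right _ _).trans h
  -- The coordinates of `b` agree, so subtracting the two displacements eliminates both `b` and `m`.
  have h3 : (2 : ℝ) • w = (m + w - b.1) - (m - w - b.2) := by
    rw [hb', two_smul]
    abel
  have h4 := norm_sub_le (m + w - b.1) (m - w - b.2)
  rw [← h3, norm_smul, Real.norm_ofNat] at h4
  linarith

/-- Half the sum of the values of `f` at the two points of a pair. -/
noncomputable def halfSum {X : Type u} (f : X → LInf) (p : Sq X) : LInf :=
  (1 / 2 : ℝ) • (f p.1 + f p.2)

/-- Half the difference of the values of `f` at the two points of a pair. -/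
noncomputable def halfDiff {X : Type u} (f : X → LInf) (p : Sq X) : LInf :=
  (1 / 2 : ℝ) • (f p.1 - f p.2)

theorem symmPair_halfSum_halfDiff {X : Type u} (f : X → LInf) (p : Sq X) :
    symmPair (halfSum f p) (halfDiff f p) = sqMap f p := by
  refine Prod.ext ?_ ?_
  · change halfSum f p + halfDiff f p = f p.1
    simp only [halfSum, halfDiff]
    module
  · change halfSum f p - halfDiff f p = f p.2
    simp only [halfSum, halfDiff]
    module

theorem norm_sub_le_dist_sqMap {X : Type u} (f : X → LInf) (p q : Sq X) :
    ‖f p.1 - f q.1‖ ≤ dist (sqMap f p) (sqMap f q) ∧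
      ‖f p.2 - f q.2‖ ≤ dist (sqMap f p) (sqMap f q) := by
  simp only [← dist_eq_norm]
  exact ⟨le_max_left _ _, le_max_right _ _⟩

theorem norm_halfSum_sub_le {X : Type u} (f : X → LInf) (p q : Sq X) :
    ‖halfSum f p - halfSum f q‖ ≤ dist (sqMap f p) (sqMap f q) := by
  obtain ⟨h1, h2⟩ := norm_sub_le_dist_sqMap f p q
  rw [halfSum, halfSum, ← smul_sub, add_sub_add_comm, norm_smul, Real.norm_of_nonneg (by norm_num)]
  linarith [norm_add_le (f p.1 - f q.1) (f p.2 - f q.2)]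

theorem norm_halfDiff_sub_le {X : Type u} (f : X → LInf) (p q : Sq X) :
    ‖halfDiff f p - halfDiff f q‖ ≤ dist (sqMap f p) (sqMap f q) := by
  obtain ⟨h1, h2⟩ := norm_sub_le_dist_sqMap f p q
  rw [halfDiff, halfDiff, ← smul_sub, sub_sub_sub_comm, norm_smul,
    Real.norm_of_nonneg (by norm_num)]
  linarith [norm_sub_le (f p.1 - f q.1) (f p.2 - f q.2)]

variable {X : Type u} [MetricSpace X]

theorem isCoarseHomotopy_symmPair {m w : ℕ → Sq X → LInf} {f g : Sq X → Sq LInf}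
    (h0 : ∀ p, symmPair (m 0 p) (w 0 p) = f p)
    (h1 : ∀ p, ∃ T, ∀ t, T ≤ t → symmPair (m t p) (w t p) = g p)
    (hm : ∀ t p, m t p.flip = m t p) (hw : ∀ t p, w t p.flip = -w t p)
    (hmstep : ∀ t p, ‖m t p - m (t + 1) p‖ ≤ 1) (hwstep : ∀ t p, ‖w t p - w (t + 1) p‖ ≤ 1)
    (hmb : ∀ r : ℝ, ∃ C : ℝ, ∀ t p q, dist p q ≤ r → ‖m t p - m t q‖ ≤ C)
    (hwb : ∀ r : ℝ, ∃ C : ℝ, ∀ t p q, dist p q ≤ r → ‖w t p - w t q‖ ≤ C)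
    (hprop : ∀ r : ℝ, ∃ s : ℝ, ∀ t p, ‖w t p‖ ≤ r → dist p.1 p.2 ≤ s) :
    IsCoarseHomotopy Z2 (delta X) (delta LInf) (fun t p => symmPair (m t p) (w t p)) f g where
  zero := funext h0
  eventually_eq := h1
  smul t c p := by
    rw [Sq.smul_def, Sq.smul_def]
    by_cases h : c = 1
    · rw [if_pos h, if_pos h]
    · rw [if_neg h, if_neg h, hm, hw]
      exact Prod.ext (sub_eq_add_neg _ _).symm (sub_neg_eq_add _ _)
  step := ⟨1 + 1, fun t p =>
    (dist_symmPair_le _ _ _ _).trans (add_le_add (hmstep t p) (hwstep t p))⟩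
  bornologous r := by
    obtain ⟨C, hC⟩ := hmb r
    obtain ⟨D, hD⟩ := hwb r
    exact ⟨C + D, fun t p q h =>
      (dist_symmPair_le _ _ _ _).trans (add_le_add (hC t p q h) (hD t p q h))⟩
  proper r := by
    obtain ⟨s, hs⟩ := hprop r
    refine ⟨s, fun t p ⟨b, hb, hd⟩ => ⟨((p.1, p.1) : X × X), rfl, ?_⟩⟩
    have h := hs t p (norm_le_of_dist_symmPair_le hb hd)
    refine max_le ?_ ?_
    · exact (dist_self p.1).le.trans (dist_nonneg.trans h)
    · exact (dist_comm _ _).le.trans h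

/-- An odd map to `ℓ^∞` which is bornologous and large away from the diagonal. -/
structure IsOddExpanding (w : Sq X → LInf) : Prop where
  odd : ∀ p, w p.flip = -w p
  bornologous : ∀ r : ℝ, ∃ C : ℝ, ∀ p q, dist p q ≤ r → ‖w p - w q‖ ≤ C
  proper : ∀ r : ℝ, ∃ s : ℝ, ∀ p, ‖w p‖ ≤ r → dist p.1 p.2 ≤ s

theorem IsOddExpanding.finiteTrunc {w : Sq X → LInf} (hw : IsOddExpanding w) :
    IsOddExpanding fun p => LInf.finiteTrunc (w p) where
  odd p := by rw [hw.odd, LInf.finiteTrunc_neg]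
  bornologous r := by
    obtain ⟨C, hC⟩ := hw.bornologous r
    exact ⟨3 * C, fun p q h => (LInf.norm_finiteTrunc_sub_le _ _).trans (by
      linarith [hC p q h])⟩
  proper r := by
    obtain ⟨s, hs⟩ := hw.proper (4 * r)
    exact ⟨s, fun p h => hs p ((LInf.norm_le_finiteTrunc _).trans (by linarith))⟩

/-- All windows widen at unit speed. Starting from the truncated map lets each point finish at its
own time, and widening never decreases the norm, so properness is inherited from time `0`. -/
theorem IsOddExpanding.isCoarseHomotopy_finiteTrunc {w : Sq X → LInf} (hw : IsOddExpanding w)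
    {m : Sq X → LInf} (hm : ∀ p, m p.flip = m p)
    (hmb : ∀ r : ℝ, ∃ C : ℝ, ∀ p q, dist p q ≤ r → ‖m p - m q‖ ≤ C) :
    IsCoarseHomotopy Z2 (delta X) (delta LInf)
      (fun t p => symmPair (LInf.clamp (fun _ => (t : ℝ)) (m p))
        (LInf.clamp (fun k => LInf.cutRadius (w p) k + t) (w p)))
      (fun p => symmPair 0 (LInf.finiteTrunc (w p))) (fun p => symmPair (m p) (w p)) := by
  refine isCoarseHomotopy_symmPair (fun p => ?_) (fun p => ?_) (fun t p => ?_) (fun t p => ?_)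
    (fun t p => ?_) (fun t p => ?_) (fun r => ?_) (fun r => ?_) (fun r => ?_)
  · simp only [Nat.cast_zero, add_zero, LInf.finiteTrunc]
    rw [LInf.clamp_eq_zero fun _ => le_rfl]
  -- The cut radius is at least `-‖w p‖`, so adding `2 * ‖w p‖` opens every window to `‖w p‖`.
  · obtain ⟨T, hT⟩ := exists_nat_ge (‖m p‖ + 2 * ‖w p‖)
    refine ⟨T, fun t ht => ?_⟩
    have ht' : (T : ℝ) ≤ t := by exact_mod_cast ht
    rw [LInf.clamp_eq_self fun k => by linarith [norm_nonneg (w p)],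
      LInf.clamp_eq_self fun k => ?_]
    rw [LInf.cutRadius]
    linarith [norm_nonneg (m p), LInf.headMax_le_norm (w p) k]
  · rw [hm]
  · rw [hw.odd, LInf.cutRadius_neg, LInf.clamp_neg]
  · exact LInf.norm_clamp_sub_clamp_le (fun k => by simp) (by simp)
  · exact LInf.norm_clamp_sub_clamp_le (fun k => by simp) (by simp)
  · obtain ⟨C, hC⟩ := hmb r
    exact ⟨C, fun t p q h => LInf.norm_clamp_sub_clamp_le
      (fun k => by simpa using (norm_nonneg _).trans (hC p q h)) (hC p q h)⟩
  · obtain ⟨C, hC⟩ := hw.bornologous r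
    refine ⟨3 * C, fun t p q h => LInf.norm_clamp_sub_clamp_le (fun k => ?_) ?_⟩
    · rw [add_sub_add_right_eq_sub]
      exact (LInf.abs_cutRadius_sub_le _ _ k).trans (by linarith [hC p q h])
    · linarith [hC p q h, norm_nonneg (w p - w q)]
  · obtain ⟨s, hs⟩ := hw.finiteTrunc.proper r
    exact ⟨s, fun t p h => hs p ((LInf.norm_clamp_le_norm_clamp (fun k => by
      simp) (w p)).trans h)⟩

theorem IsOddExpanding.isCoarseHomotopy_sweep {u w : Sq X → LInf} (hw : IsOddExpanding w)
    (hu : ∀ p, u p.flip = -u p)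
    (hub : ∀ r : ℝ, ∃ C : ℝ, ∀ p q, dist p q ≤ r → ‖u p - u q‖ ≤ C)
    (huw : ∀ p k, ∃ j, k ≤ j ∧ u p j = w p k) (hu0 : ∀ p, ∃ K, ∀ k, K ≤ k → u p k = 0)
    (hw0 : ∀ p, ∃ K, ∀ k, K ≤ k → w p k = 0) :
    IsCoarseHomotopy Z2 (delta X) (delta LInf)
      (fun t p => symmPair 0 (LInf.sweep t (u p) (w p)))
      (fun p => symmPair 0 (u p)) (fun p => symmPair 0 (w p)) := by
  refine isCoarseHomotopy_symmPair (m := fun _ _ => 0) (fun p => ?_) (fun p => ?_)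
    (fun t p => rfl) (fun t p => ?_) (fun t p => by simp) (fun t p => ?_)
    (fun r => ⟨0, by simp⟩) (fun r => ?_) (fun r => ?_)
  · rw [Nat.cast_zero, LInf.sweep_zero]
  · obtain ⟨T, hT⟩ := LInf.exists_sweep_eq (huw p) (hu0 p) (hw0 p)
    exact ⟨T, fun t ht => by rw [hT t ht]⟩
  · rw [hu, hw.odd, LInf.sweep_neg]
  · rw [Nat.cast_succ]
    exact LInf.norm_sweep_sub_sweep_succ_le _ _ _
  · obtain ⟨C, hC⟩ := hw.bornologous r
    obtain ⟨D, hD⟩ := hub r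
    exact ⟨2 * D + C, fun t p q h => (LInf.norm_sweep_sub_le _ _ _ _ _).trans (by
      linarith [hC p q h, hD p q h])⟩
  · obtain ⟨s, hs⟩ := hw.proper r
    exact ⟨s, fun t p h => hs p ((LInf.norm_le_sweep t.cast_nonneg (huw p)).trans h)⟩

/-! ### Coarse expanding maps -/

theorem IsCoarseExpanding.bornologous {Y : Type w} [MetricSpace Y] {f : X → Y}
    (hf : IsCoarseExpanding f) (r : ℝ) :
    ∃ C : ℝ, ∀ p q : Sq X, dist p q ≤ r → dist (sqMap f p) (sqMap f q) ≤ C := by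
  obtain ⟨-, μ, hμ, hle⟩ := hf
  refine ⟨μ (Real.toNNReal r), fun p q h => ?_⟩
  have h1 : nndist p q ≤ Real.toNNReal r := NNReal.le_toNNReal_of_coe_le h
  exact_mod_cast (hle p q).trans (hμ h1)

theorem IsCoarseExpanding.expanding {Y : Type w} [MetricSpace Y] {f : X → Y}
    (hf : IsCoarseExpanding f) (r : ℝ) :
    ∃ s : ℝ, ∀ x y : X, dist (f x) (f y) ≤ r → dist x y ≤ s := by
  obtain ⟨q, hq, hsub⟩ := hf.1 (max r 0) (le_max_right _ _)
  -- The distance to the diagonal need not be attained, hence `q + 1`; both `x` and `y` are that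
  -- close to one common point.
  refine ⟨2 * (q + 1), fun x y h => ?_⟩
  let p : Sq X := (x, y)
  let d : Sq Y := (f x, f x)
  have hd : dist (sqMap f p) d ≤ max r 0 := by
    refine max_le ?_ ?_
    · exact (dist_self (f x)).le.trans (le_max_right _ _)
    · exact (dist_comm _ _).le.trans (h.trans (le_max_left _ _))
  have hp : p ∈ Metric.cthickening q (delta X) :=
    hsub (Metric.mem_cthickening_of_dist_le _ d _ _ rfl hd)
  rw [Metric.mem_cthickening_iff] at hp
  have hlt : Metric.infEDist p (delta X) < ENNReal.ofReal (q + 1) :=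
    hp.trans_lt ((ENNReal.ofReal_lt_ofReal_iff (by linarith)).2 (by linarith))
  obtain ⟨a, ha, hpa⟩ := Metric.infEDist_lt_iff.1 hlt
  rw [edist_dist] at hpa
  have hpa' := (ENNReal.ofReal_lt_ofReal_iff (by linarith)).1 hpa
  have ha' : a.1 = a.2 := ha
  have h1 : dist x a.1 ≤ dist p a := le_max_left _ _
  have h2 : dist y a.2 ≤ dist p a := le_max_right _ _
  rw [← ha'] at h2
  linarith [dist_triangle_right x y a.1]

theorem IsCoarseExpanding.isOddExpanding_halfDiff {f : X → LInf} (hf : IsCoarseExpanding f) :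
    IsOddExpanding (halfDiff f) where
  odd p := by
    rw [halfDiff, halfDiff, ← smul_neg, neg_sub]
    rfl
  bornologous r := by
    obtain ⟨C, hC⟩ := hf.bornologous r
    exact ⟨C, fun p q h => (norm_halfDiff_sub_le f p q).trans (hC p q h)⟩
  proper r := by
    obtain ⟨s, hs⟩ := hf.expanding (2 * r)
    refine ⟨s, fun p h => hs _ _ ?_⟩
    rw [halfDiff, norm_smul, Real.norm_of_nonneg (by norm_num)] at h
    rw [dist_eq_norm]
    linarith

theorem IsCoarseExpanding.isCoarseHomotopy_sqMap {f : X → LInf} (hf : IsCoarseExpanding f) :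
    ∃ H, IsCoarseHomotopy Z2 (delta X) (delta LInf) H
      (fun p => symmPair 0 (LInf.finiteTrunc (halfDiff f p))) (sqMap f) := by
  have h := hf.isOddExpanding_halfDiff.isCoarseHomotopy_finiteTrunc (m := halfSum f)
    (fun p => by rw [halfSum, halfSum, add_comm]; rfl) (fun r => by
      obtain ⟨C, hC⟩ := hf.bornologous r
      exact ⟨C, fun p q h => (norm_halfSum_sub_le f p q).trans (hC p q h)⟩)
  simp only [symmPair_halfSum_halfDiff] at h
  exact ⟨_, h⟩

/-- Term `k` of either sequence sits at position `2 * k` or `2 * k + 1`, never before `k`, as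
sweeping requires. -/
theorem IsOddExpanding.exists_isCoarseHomotopy_interleave {w v : Sq X → LInf}
    (hw : IsOddExpanding w) (hv : IsOddExpanding v)
    (hw0 : ∀ p, ∃ K, ∀ k, K ≤ k → w p k = 0) (hv0 : ∀ p, ∃ K, ∀ k, K ≤ k → v p k = 0) :
    (∃ H, IsCoarseHomotopy Z2 (delta X) (delta LInf) H
      (fun p => symmPair 0 (LInf.interleave (w p) (v p))) (fun p => symmPair 0 (w p))) ∧
    (∃ H, IsCoarseHomotopy Z2 (delta X) (delta LInf) H
      (fun p => symmPair 0 (LInf.interleave (w p) (v p))) (fun p => symmPair 0 (v p))) := by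
  have hodd : ∀ p : Sq X, LInf.interleave (w p.flip) (v p.flip) =
      -LInf.interleave (w p) (v p) := fun p => by rw [hw.odd, hv.odd, LInf.interleave_neg]
  have hb : ∀ r : ℝ, ∃ C : ℝ, ∀ p q, dist p q ≤ r →
      ‖LInf.interleave (w p) (v p) - LInf.interleave (w q) (v q)‖ ≤ C := fun r => by
    obtain ⟨C, hC⟩ := hw.bornologous r
    obtain ⟨D, hD⟩ := hv.bornologous r
    exact ⟨max C D, fun p q h => (LInf.norm_interleave_sub_le _ _ _ _).trans
      (max_le_max (hC p q h) (hD p q h))⟩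
  have h0 : ∀ p, ∃ K, ∀ k, K ≤ k → LInf.interleave (w p) (v p) k = 0 := fun p => by
    obtain ⟨K, hK⟩ := hw0 p
    obtain ⟨L, hL⟩ := hv0 p
    refine ⟨2 * (K + L), fun k hk => ?_⟩
    rw [LInf.interleave_apply, hK _ (by omega), hL _ (by omega), ite_self]
  refine ⟨⟨_, hw.isCoarseHomotopy_sweep hodd hb (fun p k => ⟨2 * k, by omega, ?_⟩) h0 hw0⟩,
    ⟨_, hv.isCoarseHomotopy_sweep hodd hb (fun p k => ⟨2 * k + 1, by omega, ?_⟩) h0 hv0⟩⟩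
  · rw [LInf.interleave_apply, if_pos (even_two_mul k), Nat.mul_div_cancel_left _ two_pos]
  · rw [LInf.interleave_apply, if_neg (Nat.not_even_two_mul_add_one k),
      show (2 * k + 1) / 2 = k by omega]

/-- On the pair of points `(σ 0, τ 0)` the coboundary is `φ τ - φ σ`. -/
theorem eq_of_coboundary_eq_zero {Y : Type u} {R : Type v} [AddCommGroup R]
    {φ : Cochain Y R 0} (hφ : coboundary Y R 0 φ = 0) (σ τ : Fin 1 → Y) : φ σ = φ τ := by
  have h := congrFun hφ ![σ 0, τ 0]
  rw [coboundary_apply, Fin.sum_univ_two] at h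
  have h0 : (fun j : Fin 1 => (![σ 0, τ 0] : Fin 2 → Y) ((0 : Fin 2).succAbove j)) = τ := by
    funext j
    rw [Subsingleton.elim j 0]
    rfl
  have h1 : (fun j : Fin 1 => (![σ 0, τ 0] : Fin 2 → Y) ((1 : Fin 2).succAbove j)) = σ := by
    funext j
    rw [Subsingleton.elim j 0]
    rfl
  rw [h0, h1] at h
  simp only [Fin.val_zero, pow_zero, one_smul, Fin.val_one, pow_one, neg_smul, Pi.zero_apply] at h
  exact (add_neg_eq_zero.1 h).symm

/-! ### Comparison of the two induced maps. -/

variable {R : Type v} [AddCommGroup R] [DistribMulAction Z2 R]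

/-- Coarse expanding maps to `ℓ^∞` pull a cocycle back to cohomologous cocycles. -/
theorem IsCoarseExpanding.exists_coboundary_eq {f g : X → LInf} (hf : IsCoarseExpanding f)
    (hg : IsCoarseExpanding g) {n : ℕ} {φ : Cochain (Sq LInf) R (n + 1)}
    (hφ : φ ∈ eqCoarseCochain Z2 R (delta LInf) (n + 1))
    (hd : coboundary (Sq LInf) R (n + 1) φ = 0) :
    ∃ ψ ∈ eqCoarseCochain Z2 R (delta X) n, coboundary (Sq X) R n ψ =
      fun σ => φ (fun i => sqMap g (σ i)) - φ (fun i => sqMap f (σ i)) := by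
  obtain ⟨_, hF⟩ := hf.isCoarseHomotopy_sqMap
  obtain ⟨_, hG⟩ := hg.isCoarseHomotopy_sqMap
  obtain ⟨⟨_, hU⟩, ⟨_, hV⟩⟩ :=
    hf.isOddExpanding_halfDiff.finiteTrunc.exists_isCoarseHomotopy_interleave
      hg.isOddExpanding_halfDiff.finiteTrunc
      (fun p => LInf.exists_finiteTrunc_apply_eq_zero _)
      (fun p => LInf.exists_finiteTrunc_apply_eq_zero _)
  obtain ⟨a, ha, hda⟩ := hF.exists_coboundary_eq hφ hd
  obtain ⟨b, hb, hdb⟩ := hG.exists_coboundary_eq hφ hd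
  obtain ⟨c, hc, hdc⟩ := hU.exists_coboundary_eq hφ hd
  obtain ⟨e, he, hde⟩ := hV.exists_coboundary_eq hφ hd
  -- The homotopies run from the interleaving to each truncation and from there to `sqMap f` or
  -- `sqMap g`. The branch towards `f` is traversed backwards, hence the signs of `a` and `c`.
  refine ⟨b - a + (e - c), add_mem (sub_mem hb ha) (sub_mem he hc), ?_⟩
  rw [map_add, map_sub, map_sub, hda, hdb, hdc, hde]
  funext σ
  simp only [Pi.add_apply, Pi.sub_apply]
  abel

end CoarseConf

theorem propositionT {X : Type u} [MetricSpace X]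
    {R : Type v} [AddCommGroup R] [DistribMulAction CoarseConf.Z2 R]
    (f g : X → CoarseConf.LInf)
    (hf : CoarseConf.IsCoarseExpanding f) (hg : CoarseConf.IsCoarseExpanding g) (n : ℕ) :
    CoarseConf.confMap R f hf n = CoarseConf.confMap R g hg n := by
  refine AddMonoidHom.ext fun e => ?_
  obtain ⟨φ, rfl⟩ := QuotientAddGroup.mk_surjective e
  refine QuotientAddGroup.eq.2 ?_
  have hd : CoarseConf.coboundary _ R n φ.1.1 = 0 :=
    congrArg Subtype.val (AddMonoidHom.mem_ker.1 φ.2)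
  cases n with
  | zero =>
    -- Only zero is a coboundary in degree `0`, so the pulled-back cochains themselves must agree.
    refine AddSubgroup.mem_addSubgroupOf.2 (Subtype.ext (funext fun σ => ?_))
    exact neg_add_eq_zero.2 (CoarseConf.eq_of_coboundary_eq_zero hd _ _)
  | succ n =>
    obtain ⟨ψ, hψ, h⟩ := hf.exists_coboundary_eq hg φ.1.2 hd
    refine AddSubgroup.mem_addSubgroupOf.2 ⟨⟨ψ, hψ⟩, Subtype.ext (h.trans (funext fun σ => ?_))⟩
    exact (neg_add_eq_sub _ _).symm
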